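/- Let $p$ be a prime number, let $\Gamma_0(p)\subset \mathrm{SL}_2(\mathbb Z)$ be the subgroup of matrices $\begin{pmatrix}a&b\\c&d\end{pmatrix}$ with $p\mid c$, and let $$\widetilde\Gamma=\left\{\begin{pmatrix}a&b\\c&d\end{pmatrix}\in\Gamma_0(p) : a^{12}\equiv 1 \pmod p\right\}.$$ For a subgroup $\Gamma$ of finite index in $\mathrm{SL}_2(\mathbb Z)$, let $X_\Gamma=\Gamma\backslash(\mathbb H\cup\mathbb P^1(\mathbb Q))$ be the corresponding modular curve, regarded as a compact Riemann surface; its cusps are the images of the points of $\mathbb P^1(\mathbb Q)$. Write $X_0(p)=X_{\Gamma_0(p)}$, and let $\pi\colon X_{\widetilde\Gamma}\to X_0(p)$ be the natural map. Then: 1. if $p\neq 2$, then $\deg\pi\le \dfrac{p-1}{2}$; 2. if $p\notin\{2,3,5,7,13\}$, then $X_{\widetilde\Gamma}$ has at least $3$ cusps; 3. $\pi$ is étale, that is, a local isomorphism at every point of $X_{\widetilde\Gamma}$, including the cusps. (Here $\deg\pi$ is the number of points of all but finitely many fibres of $\pi$.) -/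

import Mathlib

open scoped MatrixGroups Manifold UpperHalfPlane

noncomputable section

/-- The subgroup `Γ̃` of `Γ₀(p)` of the matrices whose upper left entry `a` satisfies
`a ^ 12 = 1` in `ℤ/pℤ`. -/
def GammaTilde (p : ℕ) : Subgroup SL(2, ℤ) where
  carrier := {γ | γ ∈ CongruenceSubgroup.Gamma0 p ∧ ((γ 0 0 : ℤ) : ZMod p) ^ 12 = 1}
  one_mem' := ⟨one_mem _, by simp⟩
  mul_mem' := by
    rintro a b ⟨ha, ha'⟩ ⟨hb, hb'⟩
    refine ⟨mul_mem ha hb, ?_⟩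
    rw [CongruenceSubgroup.Gamma0_mem] at hb
    have h := (Matrix.two_mul_expl a.1 b.1).1
    rw [Matrix.SpecialLinearGroup.coe_mul, h]
    push_cast
    rw [hb, mul_zero, add_zero, mul_pow, ha', hb', one_mul]
  inv_mem' := by
    rintro a ⟨ha, ha'⟩
    refine ⟨inv_mem ha, ?_⟩
    rw [CongruenceSubgroup.Gamma0_mem] at ha
    have hdet : ((a 0 0 : ℤ) : ZMod p) * ((a 1 1 : ℤ) : ZMod p) = 1 := by
      have h := congrArg (Int.cast : ℤ → ZMod p) a.2
      rw [Matrix.det_fin_two] at h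
      push_cast at h
      rw [ha, mul_zero, sub_zero] at h
      exact h
    have hinv : (a⁻¹ : SL(2, ℤ)) 0 0 = a 1 1 := by
      simp [Matrix.SpecialLinearGroup.SL2_inv_expl a]
    have h := congrArg (fun x => x ^ 12) hdet
    simp only [mul_pow, ha', one_mul, one_pow] at h
    rw [hinv]
    exact h

theorem GammaTilde_le (p : ℕ) : GammaTilde p ≤ CongruenceSubgroup.Gamma0 p :=
  fun _ h => h.1

/-- The extended upper half plane `ℍ* = ℍ ∪ ℙ¹(ℚ)`. -/
inductive ExtendedUpperHalfPlane : Type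
  | point (z : ℍ)
  | cusp (c : OnePoint ℚ)

namespace ExtendedUpperHalfPlane

/-- `SL(2, ℤ)` acts on `ℍ*` by Möbius transformations. -/
instance : MulAction SL(2, ℤ) ExtendedUpperHalfPlane where
  smul γ x := match x with
    | point z => point (γ • z)
    | cusp c => cusp (Matrix.SpecialLinearGroup.mapGL ℚ γ • c)
  one_smul x := match x with
    | point z => congrArg point (one_smul _ z)
    | cusp c => congrArg cusp (by rw [map_one, one_smul])
  mul_smul γ δ x := match x with
    | point z => congrArg point (mul_smul γ δ z)
    | cusp c => congrArg cusp (by rw [map_mul, mul_smul])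

/-- The usual topology of `ℍ*`: a neighbourhood of a cusp `γ ∞`, where `γ ∈ SL(2, ℤ)`, is a set
that contains this cusp and the image under `γ` of some half plane `{z | C < Im z}`. -/
instance : TopologicalSpace ExtendedUpperHalfPlane where
  IsOpen U := IsOpen {z : ℍ | point z ∈ U} ∧
    ∀ γ : SL(2, ℤ), γ • cusp OnePoint.infty ∈ U →
      ∃ C : ℝ, ∀ z : ℍ, C < z.im → γ • point z ∈ U
  isOpen_univ := ⟨by simp, fun _ _ => ⟨0, fun _ _ => trivial⟩⟩
  isOpen_inter := by
    rintro U V ⟨hU, hU'⟩ ⟨hV, hV'⟩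
    refine ⟨hU.inter hV, fun γ hγ => ?_⟩
    obtain ⟨C, hC⟩ := hU' γ hγ.1
    obtain ⟨D, hD⟩ := hV' γ hγ.2
    exact ⟨max C D, fun z hz =>
      ⟨hC z ((le_max_left _ _).trans_lt hz), hD z ((le_max_right _ _).trans_lt hz)⟩⟩
  isOpen_sUnion := by
    intro S hS
    refine ⟨?_, ?_⟩
    · have h : {z : ℍ | point z ∈ ⋃₀ S} = ⋃ U ∈ S, {z : ℍ | point z ∈ U} := by
        ext z; simp
      rw [h]
      exact isOpen_biUnion fun U hU => (hS U hU).1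
    · rintro γ ⟨U, hU, hγ⟩
      obtain ⟨C, hC⟩ := (hS U hU).2 γ hγ
      exact ⟨C, fun z hz => ⟨U, hU, hC z hz⟩⟩

end ExtendedUpperHalfPlane

/-- The modular curve `X_Γ = Γ \ ℍ*` of a subgroup `Γ` of `SL(2, ℤ)`. -/
def ModularCurve (Γ : Subgroup SL(2, ℤ)) : Type :=
  Quotient (MulAction.orbitRel Γ ExtendedUpperHalfPlane)

namespace ModularCurve

variable {Γ Γ' : Subgroup SL(2, ℤ)}

/-- The quotient topology. -/
instance : TopologicalSpace (ModularCurve Γ) :=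
  inferInstanceAs (TopologicalSpace (Quotient (MulAction.orbitRel Γ ExtendedUpperHalfPlane)))

/-- The quotient map `ℍ* → X_Γ`. -/
def mk (Γ : Subgroup SL(2, ℤ)) (x : ExtendedUpperHalfPlane) : ModularCurve Γ :=
  Quotient.mk (MulAction.orbitRel Γ ExtendedUpperHalfPlane) x

/-- The cusps of `X_Γ`: the points that come from `ℙ¹(ℚ)`. -/
def cusps (Γ : Subgroup SL(2, ℤ)) : Set (ModularCurve Γ) :=
  Set.range fun c : OnePoint ℚ => mk Γ (ExtendedUpperHalfPlane.cusp c)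

/-- The complex structure of `X_Γ`, given by its sheaf of holomorphic functions: a function `f` on
an open subset `V` of `X_Γ` is holomorphic if it is continuous on `V` and its pullback to the
preimage of `V` in `ℍ` is holomorphic. At a cusp, with local parameter `q = exp (2 π i z / h)`,
this is the usual condition by the removable singularity theorem; at an elliptic point it says
that `f` is a holomorphic function of the usual local parameter, because the pullback is
invariant under the stabilizer of the point. -/
def IsHolomorphicOn (f : ModularCurve Γ → ℂ) (V : Set (ModularCurve Γ)) : Prop :=
  ContinuousOn f V ∧
    MDifferentiableOn 𝓘(ℂ) 𝓘(ℂ) (fun z : ℍ => f (mk Γ (ExtendedUpperHalfPlane.point z)))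
      {z : ℍ | mk Γ (ExtendedUpperHalfPlane.point z) ∈ V}

/-- The natural map `X_Γ → X_Γ'` for `Γ ≤ Γ'`, which sends `Γ x` to `Γ' x`. -/
def map (h : Γ ≤ Γ') : ModularCurve Γ → ModularCurve Γ' :=
  Quotient.map' id fun _ _ ⟨γ, hγ⟩ => ⟨⟨γ.1, h γ.2⟩, hγ⟩

/-- The map `π : X_Γ → X_Γ'` is étale at `x`: it is a local isomorphism of complex curves at `x`,
that is, it restricts to a homeomorphism from an open neighbourhood of `x` onto an open subset of
`X_Γ'` which identifies the holomorphic functions on the two sides. -/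
def IsEtaleAt (π : ModularCurve Γ → ModularCurve Γ') (x : ModularCurve Γ) : Prop :=
  ∃ e : OpenPartialHomeomorph (ModularCurve Γ) (ModularCurve Γ'),
    x ∈ e.source ∧ Set.EqOn e π e.source ∧
      ∀ V ⊆ e.target, IsOpen V → ∀ f : ModularCurve Γ' → ℂ,
        IsHolomorphicOn f V ↔ IsHolomorphicOn (f ∘ π) (e.source ∩ π ⁻¹' V)

/-- The map `π` is étale, at every point of `X_Γ`, cusps and elliptic points included. -/
def IsEtale (π : ModularCurve Γ → ModularCurve Γ') : Prop :=
  ∀ x, IsEtaleAt π x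

/-- The map `π : X_Γ → X_Γ'` has degree `d`: all but finitely many of its fibres have exactly
`d` points. -/
def HasDegree (π : ModularCurve Γ → ModularCurve Γ') (d : ℕ) : Prop :=
  {y : ModularCurve Γ' | (π ⁻¹' {y}).encard ≠ d}.Finite

end ModularCurve

end

/-!
The argument rests on two facts about traces.

* Every point `x` of `ℍ*` has an open neighbourhood `U` such that an element of `SL(2, ℤ)` that
  maps some point of `U` into `U` has trace of absolute value at most `2`
  (`ExtendedUpperHalfPlane.exists_isOpen_abs_trace_le_two`). At a point of `ℍ` this is the lower
  bound for the displacement of a hyperbolic element; at a cusp `δ ∞` one takes the image under `δ`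
  of the horoball `1 < Im z`.
* An element of `Γ₀(p)` with trace `t`, `|t| ≤ 2`, lies in `Γ̃`: its upper left entry is a root of
  `X ^ 2 - t X + 1` modulo `p`, so it is a root of unity of order dividing `12`, because this
  polynomial is `(X ± 1) ^ 2` or divides `X ^ 12 - 1`
  (`mem_GammaTilde_of_abs_trace_le_two`).

Together they show that the stabilizers in `Γ₀(p)` of all points of `ℍ*` lie in `Γ̃` and that `π` is
injective on the image of `U`. As `π` is continuous and open, it is a local homeomorphism, and it
respects holomorphic functions because these are defined by pullback to `ℍ`.

Since `Γ̃` is the kernel of the character `γ ↦ a ^ 12` of `Γ₀(p)` and contains the stabilizers,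
each fibre of `π`, without exception, is in bijection with the set of nonzero twelfth powers in
`ℤ/pℤ`. For odd `p` these are roots of `X ^ ((p - 1) / 2) - 1`, which bounds the degree. If
`p ∉ {2, 3, 5, 7, 13}` there are at least two of them, hence at least two cusps of `X_Γ̃` above the
cusp `∞` of `X₀(p)`, and there is a further cusp above the cusp `0 = S ∞`.
-/

open CongruenceSubgroup Topology

/-! ### Displacement in the upper half plane -/

namespace UpperHalfPlane

/-- A lower bound for the displacement of `w` under `γ`. Writing `γ • w - w = -Q / (c w + d)` with
`Q = c w² + (d - a) w - b`, it says that `|Q|² ≥ (Im w)² disc Q`, where `disc Q = tr(γ)² - 4`. -/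
theorem trace_sq_sub_four_mul_le (γ : SL(2, ℤ)) (w : ℍ) :
    ((γ.1.trace : ℝ) ^ 2 - 4) * (w.im * (γ • w).im) ≤ Complex.normSq ((γ • w : ℍ) - w : ℂ) := by
  have hdet : ((γ 0 0 : ℤ) : ℝ) * (γ 1 1 : ℤ) - (γ 0 1 : ℤ) * (γ 1 0 : ℤ) = 1 := by
    have h := γ.2
    rw [Matrix.det_fin_two] at h
    exact_mod_cast h
  have hD : ((γ 1 0 : ℤ) : ℂ) * w + (γ 1 1 : ℤ) ≠ 0 := by
    simpa [ModularGroup.denom_apply] using denom_ne_zero γ w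
  have hN := Complex.normSq_pos.2 hD
  have h1 : ((γ • w : ℍ) - w : ℂ) * (((γ 1 0 : ℤ) : ℂ) * w + (γ 1 1 : ℤ)) =
      (γ 0 0 : ℤ) * w + (γ 0 1 : ℤ) - w * (((γ 1 0 : ℤ) : ℂ) * w + (γ 1 1 : ℤ)) := by
    rw [coe_specialLinearGroup_apply, sub_mul]
    simp only [algebraMap_int_eq, eq_intCast, Complex.ofReal_intCast]
    rw [div_mul_cancel₀ _ hD]
  have h2 : (γ • w).im * Complex.normSq (((γ 1 0 : ℤ) : ℂ) * w + (γ 1 1 : ℤ)) = w.im := by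
    rw [ModularGroup.im_smul_eq_div_normSq, ModularGroup.denom_apply,
      div_mul_cancel₀ _ hN.ne']
  refine le_of_mul_le_mul_right ?_ hN
  rw [← Complex.normSq_mul, h1, mul_assoc, mul_assoc, h2, Matrix.trace_fin_two]
  simp only [Complex.normSq_apply, Complex.add_re, Complex.sub_re, Complex.mul_re, Complex.add_im,
    Complex.sub_im, Complex.mul_im, Complex.intCast_re, Complex.intCast_im, coe_re, coe_im]
  push_cast
  change ((((γ 0 0 : ℤ) : ℝ) + (γ 1 1 : ℤ)) ^ 2 - 4) * _ ≤ _
  generalize ((γ 0 0 : ℤ) : ℝ) = a at *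
  generalize ((γ 0 1 : ℤ) : ℝ) = b at *
  generalize ((γ 1 0 : ℤ) : ℝ) = c at *
  generalize ((γ 1 1 : ℤ) : ℝ) = d at *
  generalize w.re = x
  generalize w.im = y
  -- The difference of the two sides is a square, up to a multiple of `det γ - 1`.
  have hsq := sq_nonneg (c * x ^ 2 + (d - a) * x - b + c * y ^ 2)
  linear_combination hsq + 4 * y ^ 2 * hdet

end UpperHalfPlane

/-! ### Local behaviour of the action on the extended upper half plane -/

namespace ExtendedUpperHalfPlane

theorem smul_point (γ : SL(2, ℤ)) (z : ℍ) : γ • point z = point (γ • z) := rfl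

theorem smul_cusp (γ : SL(2, ℤ)) (c : OnePoint ℚ) :
    γ • cusp c = cusp (Matrix.SpecialLinearGroup.mapGL ℚ γ • c) := rfl

theorem smul_cusp_infty_eq_iff {γ : SL(2, ℤ)} :
    γ • cusp OnePoint.infty = cusp OnePoint.infty ↔ γ 1 0 = 0 := by
  rw [smul_cusp, cusp.injEq, OnePoint.smul_infty_eq_self_iff]
  simp

theorem exists_smul_infty_eq (c : OnePoint ℚ) :
    ∃ δ : SL(2, ℤ), δ • cusp OnePoint.infty = cusp c := by
  obtain ⟨δ, hδ⟩ := c.exists_mem_SL2 ℤ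
  exact ⟨δ, congrArg cusp hδ⟩

instance : ContinuousConstSMul SL(2, ℤ) ExtendedUpperHalfPlane where
  continuous_const_smul γ := by
    refine ⟨fun U hU => ⟨?_, fun δ hδ => ?_⟩⟩
    · exact hU.1.preimage
        (continuous_const_smul (Matrix.SpecialLinearGroup.mapGL ℝ γ) : Continuous fun z : ℍ => _)
    · obtain ⟨C, hC⟩ := hU.2 (γ * δ) (by simpa [mul_smul] using hδ)
      exact ⟨C, fun z hz => by simpa [mul_smul] using hC z hz⟩

theorem abs_trace_le_two_of_apply_one_zero {γ : SL(2, ℤ)} (h : γ 1 0 = 0) :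
    |γ.1.trace| ≤ 2 := by
  have hdet := γ.2
  rw [Matrix.det_fin_two] at hdet
  have h' : γ.1 1 0 = 0 := h
  rw [h', mul_zero, sub_zero] at hdet
  rw [Matrix.trace_fin_two]
  rcases Int.eq_one_or_neg_one_of_mul_eq_one' hdet with ⟨h0, h1⟩ | ⟨h0, h1⟩ <;> simp [h0, h1]

theorem im_smul_of_apply_one_zero {γ : SL(2, ℤ)} (h : γ 1 0 = 0) (z : ℍ) :
    (γ • z).im = z.im := by
  have hdet := γ.2
  rw [Matrix.det_fin_two] at hdet
  have h' : γ.1 1 0 = 0 := h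
  rw [h', mul_zero, sub_zero] at hdet
  rw [ModularGroup.im_smul_eq_div_normSq, ModularGroup.denom_apply, h]
  rcases Int.eq_one_or_neg_one_of_mul_eq_one' hdet with ⟨h0, h1⟩ | ⟨h0, h1⟩ <;>
    simp [show γ 1 1 = _ from h1]

/-- The horoball `1 < Im z` meets its translates only under the stabilizer of `∞`. -/
theorem apply_one_zero_of_one_lt_im {γ : SL(2, ℤ)} {z : ℍ} (hz : 1 < z.im)
    (hγz : 1 < (γ • z).im) : γ 1 0 = 0 := by
  by_contra h
  have h1 : (1 : ℝ) ≤ ((γ 1 0 : ℤ) : ℝ) ^ 2 := by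
    exact_mod_cast Int.add_one_le_iff.2 (sq_pos_of_ne_zero h)
  have hN := UpperHalfPlane.c_mul_im_sq_le_normSq_denom (γ : GL (Fin 2) ℝ) z
  have hpos := UpperHalfPlane.normSq_denom_pos (γ : GL (Fin 2) ℝ) z.im_ne_zero
  rw [ModularGroup.im_smul_eq_div_normSq, lt_div_iff₀ hpos] at hγz
  replace hN : (((γ 1 0 : ℤ) : ℝ) * z.im) ^ 2 ≤
      Complex.normSq (UpperHalfPlane.denom (γ : GL (Fin 2) ℝ) z) := by simpa using hN
  rw [one_mul] at hγz
  have h2 : z.im ^ 2 ≤ (((γ 1 0 : ℤ) : ℝ) * z.im) ^ 2 := by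
    rw [mul_pow]
    exact le_mul_of_one_le_left (sq_nonneg _) h1
  nlinarith

/-- Elements that move a point only a little are elliptic, parabolic or `± 1`. This replaces the
proper discontinuity of the action: no finiteness of the stabilizers is needed. -/
theorem exists_isOpen_abs_trace_le_two (x : ExtendedUpperHalfPlane) :
    ∃ U : Set ExtendedUpperHalfPlane, IsOpen U ∧ x ∈ U ∧
      ∀ γ : SL(2, ℤ), ∀ u ∈ U, γ • u ∈ U → |γ.1.trace| ≤ 2 := by
  cases x with
  | point z =>
    -- The constant `5` is the least value of `t ^ 2 - 4` for an integer `t` with `2 < |t|`.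
    have hO : IsOpen {q : ℍ × ℍ |
        Complex.normSq ((q.2 : ℂ) - q.1) < 5 * (q.1.im * q.2.im)} := by
      refine isOpen_lt ?_ ?_
      · exact Complex.continuous_normSq.comp (by fun_prop)
      · exact continuous_const.mul ((UpperHalfPlane.continuous_im.comp continuous_fst).mul
          (UpperHalfPlane.continuous_im.comp continuous_snd))
    have hz : (z, z) ∈ {q : ℍ × ℍ |
        Complex.normSq ((q.2 : ℂ) - q.1) < 5 * (q.1.im * q.2.im)} := by
      simpa using mul_pos z.im_pos z.im_pos
    obtain ⟨A, B, hA, hB, hzA, hzB, hAB⟩ := isOpen_prod_iff.1 hO z z hz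
    refine ⟨point '' (A ∩ B), ⟨?_, ?_⟩, ⟨z, ⟨hzA, hzB⟩, rfl⟩, ?_⟩
    · simpa using hA.inter hB
    · rintro γ ⟨w, -, hw⟩
      cases hw
    · rintro γ _ ⟨w, hw, rfl⟩ ⟨v, hv, hvw⟩
      have hvw' : v = γ • w := point.inj hvw
      subst hvw'
      have h1 : Complex.normSq ((γ • w : ℍ) - w : ℂ) < 5 * (w.im * (γ • w).im) :=
        hAB (Set.mk_mem_prod hw.1 hv.2)
      have h2 := (UpperHalfPlane.trace_sq_sub_four_mul_le γ w).trans_lt h1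
      have h3 : ((γ.1.trace : ℝ) ^ 2 - 4) < 5 :=
        lt_of_mul_lt_mul_right h2 (mul_pos w.im_pos (γ • w).im_pos).le
      have h4 : γ.1.trace ^ 2 < 3 ^ 2 := by
        have : (γ.1.trace : ℝ) ^ 2 < 3 ^ 2 := by linarith
        exact_mod_cast this
      have := abs_lt_of_sq_lt_sq h4 (by norm_num)
      lia
  | cusp c =>
    obtain ⟨δ, hδ⟩ := exists_smul_infty_eq c
    rw [← hδ]
    let H : Set ExtendedUpperHalfPlane := insert (cusp OnePoint.infty) (point '' {z | 1 < z.im})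
    have hH : IsOpen H := by
      refine ⟨?_, fun γ hγ => ⟨1, fun z hz => ?_⟩⟩
      · simpa [H] using isOpen_lt continuous_const UpperHalfPlane.continuous_im
      · rcases hγ with hγ | ⟨w, -, hw⟩
        · refine Or.inr ⟨γ • z, ?_, rfl⟩
          exact hz.trans_eq (im_smul_of_apply_one_zero (smul_cusp_infty_eq_iff.1 hγ) z).symm
        · cases hw
    have key : ∀ γ : SL(2, ℤ), ∀ u ∈ H, γ • u ∈ H → γ 1 0 = 0 := by
      rintro γ _ (rfl | ⟨w, hw, rfl⟩) (h | ⟨v, hv, h⟩)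
      · exact smul_cusp_infty_eq_iff.1 h
      · cases h
      · cases h
      · have hvw : v = γ • w := point.inj h
        exact apply_one_zero_of_one_lt_im hw (hvw ▸ hv)
    refine ⟨(fun u => δ⁻¹ • u) ⁻¹' H, hH.preimage (continuous_const_smul δ⁻¹), ?_, ?_⟩
    · simp [H]
    · intro γ u hu hγu
      have h := abs_trace_le_two_of_apply_one_zero
        (key (δ⁻¹ * γ * δ) (δ⁻¹ • u) hu (by simpa [mul_smul] using hγu))
      have ht : (δ⁻¹ * γ * δ).1.trace = γ.1.trace := by
        have hconj : δ * (δ⁻¹ * γ) = γ := mul_inv_cancel_left δ γ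
        conv_rhs => rw [← hconj]
        exact Matrix.trace_mul_comm _ _
      rwa [ht] at h

theorem abs_trace_le_two_of_smul_eq {γ : SL(2, ℤ)} {x : ExtendedUpperHalfPlane}
    (h : γ • x = x) : |γ.1.trace| ≤ 2 := by
  obtain ⟨U, -, hx, hU⟩ := exists_isOpen_abs_trace_le_two x
  exact hU γ x hx (by rwa [h])

end ExtendedUpperHalfPlane

/-! ### The character of `Γ₀(p)` with kernel `Γ̃` -/

theorem gamma0_apply_mul_apply {p : ℕ} {γ : SL(2, ℤ)} (h : γ ∈ Gamma0 p) :
    ((γ 0 0 : ℤ) : ZMod p) * ((γ 1 1 : ℤ) : ZMod p) = 1 := by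
  rw [Gamma0_mem] at h
  have hd := congrArg (Int.cast : ℤ → ZMod p) γ.2
  rw [Matrix.det_fin_two] at hd
  push_cast at hd
  rwa [h, mul_zero, sub_zero] at hd

/-- The upper left entry `a` satisfies `a² - t a + 1 = 0` in `ℤ/pℤ`, where `t` is the trace. For
`|t| ≤ 1` this polynomial divides `X ^ 12 - 1`; for `t = ± 2` it forces `a = ± 1`. -/
theorem mem_GammaTilde_of_abs_trace_le_two {p : ℕ} [Fact p.Prime] {γ : SL(2, ℤ)}
    (h : γ ∈ Gamma0 p) (ht : |γ.1.trace| ≤ 2) : γ ∈ GammaTilde p := by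
  refine ⟨h, ?_⟩
  have had := gamma0_apply_mul_apply h
  have htr : ((γ.1.trace : ℤ) : ZMod p) = (γ 0 0 : ℤ) + (γ 1 1 : ℤ) := by
    rw [Matrix.trace_fin_two]; push_cast; rfl
  generalize ((γ 0 0 : ℤ) : ZMod p) = a at *
  generalize ((γ 1 1 : ℤ) : ZMod p) = d at *
  generalize γ.1.trace = t at *
  have hpoly : a ^ 2 - t * a + 1 = 0 := by rw [htr]; linear_combination -had
  obtain ⟨h1, h2⟩ := abs_le.1 ht
  clear htr had
  interval_cases t <;> push_cast at hpoly
  · have : (a + 1) ^ 2 = 0 := by linear_combination hpoly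
    rw [eq_neg_of_add_eq_zero_left (pow_eq_zero_iff two_ne_zero |>.1 this)]
    norm_num
  · linear_combination (a - 1) * (a + 1) * (a ^ 2 - a + 1) * (a ^ 2 + 1) *
      (a ^ 4 - a ^ 2 + 1) * hpoly
  · linear_combination (a - 1) * (a + 1) * (a ^ 2 - a + 1) * (a ^ 2 + a + 1) *
      (a ^ 4 - a ^ 2 + 1) * hpoly
  · linear_combination (a - 1) * (a + 1) * (a ^ 2 + a + 1) * (a ^ 2 + 1) *
      (a ^ 4 - a ^ 2 + 1) * hpoly
  · have : (a - 1) ^ 2 = 0 := by linear_combination hpoly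
    rw [sub_eq_zero.1 (pow_eq_zero_iff two_ne_zero |>.1 this)]
    norm_num

/-- The character `γ ↦ a ^ 12` of `Γ₀(p)`, where `a` is the upper left entry of `γ`; its kernel
is `Γ̃`. -/
def gamma0Character (p : ℕ) : Gamma0 p →* ZMod p where
  toFun γ := ((γ.1 0 0 : ℤ) : ZMod p) ^ 12
  map_one' := by simp
  map_mul' := by
    rintro ⟨a, ha⟩ ⟨b, hb⟩
    rw [Gamma0_mem] at hb
    have h := (Matrix.two_mul_expl a.1 b.1).1
    simp only [Subgroup.coe_mul, Matrix.SpecialLinearGroup.coe_mul]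
    rw [h]
    push_cast
    rw [hb, mul_zero, add_zero, mul_pow]

theorem gamma0Character_eq_one_iff {p : ℕ} {γ : Gamma0 p} :
    gamma0Character p γ = 1 ↔ (γ : SL(2, ℤ)) ∈ GammaTilde p :=
  ⟨fun h => ⟨γ.2, h⟩, fun h => h.2⟩

theorem range_gamma0Character (p : ℕ) [Fact p.Prime] :
    Set.range (gamma0Character p) = {v | ∃ u : ZMod p, u ≠ 0 ∧ u ^ 12 = v} := by
  ext v
  constructor
  · rintro ⟨γ, rfl⟩
    exact ⟨_, left_ne_zero_of_mul_eq_one (gamma0_apply_mul_apply γ.2), rfl⟩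
  · rintro ⟨u, hu, rfl⟩
    obtain ⟨a, rfl⟩ := ZMod.intCast_surjective u
    have hco : IsCoprime a (p : ℤ) := by
      rw [isCoprime_comm, (Nat.prime_iff_prime_int.1 Fact.out).coprime_iff_not_dvd]
      rwa [Ne, ZMod.intCast_zmod_eq_zero_iff_dvd] at hu
    obtain ⟨d, b, hdb⟩ := hco
    refine ⟨⟨⟨!![a, -b; p, d], ?_⟩, ?_⟩, rfl⟩
    · rw [Matrix.det_fin_two_of]; linear_combination hdb
    · exact Gamma0_mem.2 (by simp)

/-- For odd `p`, a nonzero twelfth power `u ^ 12` in `ℤ/pℤ` is a root of `X ^ ((p - 1) / 2) - 1`. -/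
theorem encard_range_gamma0Character_le {p : ℕ} [Fact p.Prime] (h2 : p ≠ 2) :
    (Set.range (gamma0Character p)).encard ≤ ((p - 1) / 2 : ℕ) := by
  have hp : p.Prime := Fact.out
  obtain ⟨k, hk⟩ := hp.odd_of_ne_two h2
  have hpos : 0 < k := by have := hp.two_le; lia
  have hk1 : 12 * k = (p - 1) * 6 := by lia
  have hk2 : (p - 1) / 2 = k := by lia
  rw [hk2]
  have hsub : Set.range (gamma0Character p) ⊆
      ((Polynomial.nthRoots k (1 : ZMod p)).toFinset : Set (ZMod p)) := by
    rw [range_gamma0Character]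
    rintro _ ⟨u, hu, rfl⟩
    rw [Finset.mem_coe, Multiset.mem_toFinset, Polynomial.mem_nthRoots hpos, ← pow_mul, hk1,
      pow_mul, ZMod.pow_card_sub_one_eq_one hu, one_pow]
  refine (Set.encard_le_encard hsub).trans ?_
  rw [Set.encard_coe_eq_coe_finsetCard, Nat.cast_le]
  exact (Multiset.toFinset_card_le _).trans (Polynomial.card_nthRoots _ _)

theorem exists_gamma0Character_ne_one {p : ℕ} [Fact p.Prime]
    (h : p ∉ ({2, 3, 5, 7, 13} : Set ℕ)) : ∃ γ, gamma0Character p γ ≠ 1 := by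
  have hp : p.Prime := Fact.out
  suffices ∃ u : ZMod p, u ≠ 0 ∧ u ^ 12 ≠ 1 by
    obtain ⟨u, hu, hu1⟩ := this
    have : u ^ 12 ∈ Set.range (gamma0Character p) := by
      rw [range_gamma0Character]; exact ⟨u, hu, rfl⟩
    obtain ⟨γ, hγ⟩ := this
    exact ⟨γ, hγ ▸ hu1⟩
  -- For `13 < p` the polynomial `X ^ 12 - 1` has fewer than `p - 1` roots; for `p = 11` take `2`.
  rcases le_or_gt p 13 with h13 | h13
  · have h11 : p = 11 := by
      simp only [Set.mem_insert_iff, Set.mem_singleton_iff, not_or] at h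
      obtain ⟨h2, h3, h5, h7, h13'⟩ := h
      interval_cases p <;> first | rfl | contradiction
    have hu : ∃ u : ZMod 11, u ≠ 0 ∧ u ^ 12 ≠ 1 := ⟨2, by decide, by decide⟩
    subst h11
    exact hu
  · by_contra! hcon
    have hsub : (Finset.univ.erase (0 : ZMod p)) ⊆ (Polynomial.nthRoots 12 1).toFinset := by
      intro u hu
      rw [Multiset.mem_toFinset, Polynomial.mem_nthRoots (by norm_num)]
      exact hcon u (Finset.ne_of_mem_erase hu)
    have hcard := (Finset.card_le_card hsub).trans
      ((Multiset.toFinset_card_le _).trans (Polynomial.card_nthRoots _ _))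
    rw [Finset.card_erase_of_mem (Finset.mem_univ _), Finset.card_univ, ZMod.card] at hcard
    lia

/-! ### Maps between modular curves -/

namespace ModularCurve

open ExtendedUpperHalfPlane

variable {Γ Γ' : Subgroup SL(2, ℤ)}

theorem mk_eq_mk_iff {x y : ExtendedUpperHalfPlane} :
    mk Γ x = mk Γ y ↔ ∃ γ ∈ Γ, γ • y = x := by
  refine Quotient.eq.trans ?_
  exact ⟨fun ⟨γ, hγ⟩ => ⟨γ.1, γ.2, hγ⟩, fun ⟨γ, h, hγ⟩ => ⟨⟨γ, h⟩, hγ⟩⟩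

theorem mk_surjective : Function.Surjective (mk Γ) := Quotient.mk_surjective

theorem map_mk (h : Γ ≤ Γ') (x : ExtendedUpperHalfPlane) : map h (mk Γ x) = mk Γ' x := rfl

theorem continuous_mk : Continuous (mk Γ) := continuous_quot_mk

theorem isOpenMap_mk : IsOpenMap (mk Γ) :=
  have : ContinuousConstSMul Γ ExtendedUpperHalfPlane :=
    ⟨fun γ => continuous_const_smul (γ : SL(2, ℤ))⟩
  isOpenMap_quotient_mk'_mul (Γ := Γ) (T := ExtendedUpperHalfPlane)

theorem continuous_map (h : Γ ≤ Γ') : Continuous (map h) :=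
  continuous_quot_lift _ (continuous_mk (Γ := Γ'))

theorem isOpenMap_map (h : Γ ≤ Γ') : IsOpenMap (map h) := by
  intro V hV
  have : map h '' V = mk Γ' '' (mk Γ ⁻¹' V) := by
    rw [← Set.image_preimage_eq V mk_surjective, Set.image_image,
      Set.preimage_image_preimage]
    rfl
  rw [this]
  exact isOpenMap_mk _ (hV.preimage continuous_mk)

theorem mdifferentiable_smul (γ : SL(2, ℤ)) :
    MDifferentiable 𝓘(ℂ) 𝓘(ℂ) (fun z : ℍ => γ • z) :=
  UpperHalfPlane.mdifferentiable_smul (g := Matrix.SpecialLinearGroup.mapGL ℝ γ) (by simp)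

/-- A local homeomorphism that agrees with `X_Γ → X_Γ'` identifies the holomorphic functions: near
a point `z` of `ℍ` above `V`, the pullback of `f` is the pullback of `f ∘ map h` near a translate
`γ z` above the source, composed with `γ ∈ Γ'`. -/
theorem isHolomorphicOn_comp_map_iff (h : Γ ≤ Γ')
    (e : OpenPartialHomeomorph (ModularCurve Γ) (ModularCurve Γ'))
    (he : Set.EqOn e (map h) e.source)
    {V : Set (ModularCurve Γ')} (hV : V ⊆ e.target) (hVo : IsOpen V) (f : ModularCurve Γ' → ℂ) :
    IsHolomorphicOn f V ↔ IsHolomorphicOn (f ∘ map h) (e.source ∩ map h ⁻¹' V) := by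
  have hWo : IsOpen (e.source ∩ map h ⁻¹' V) :=
    e.open_source.inter (hVo.preimage (continuous_map h))
  have hsymm : ∀ y ∈ V, map h (e.symm y) = y := fun y hy => by
    rw [← he (e.map_target (hV hy)), e.right_inv (hV hy)]
  have hmaps : Set.MapsTo e.symm V (e.source ∩ map h ⁻¹' V) := fun y hy =>
    ⟨e.map_target (hV hy), by rwa [Set.mem_preimage, hsymm y hy]⟩
  constructor
  · rintro ⟨hc, hd⟩
    exact ⟨hc.comp (continuous_map h).continuousOn fun x hx => hx.2, hd.mono fun z hz => hz.2⟩
  · rintro ⟨hc, hd⟩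
    refine ⟨(hc.comp (e.continuousOn_symm.mono hV) hmaps).congr fun y hy =>
      (congrArg f (hsymm y hy)).symm, fun z hz => ?_⟩
    obtain ⟨x, hx⟩ := mk_surjective (e.symm (mk Γ' (point z)))
    obtain ⟨γ, hγ, rfl⟩ := mk_eq_mk_iff.1
      (show mk Γ' x = mk Γ' (point z) by rw [← map_mk h, hx, hsymm _ hz])
    have hmem : mk Γ (point (γ • z)) ∈ e.source ∩ map h ⁻¹' V := by
      rw [← smul_point, hx]; exact hmaps hz
    have hd' := (hd (γ • z) hmem).mdifferentiableAt
      ((hWo.preimage continuous_mk |>.1).mem_nhds hmem)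
    have hcomp := hd'.comp z (mdifferentiable_smul γ z)
    refine (hcomp.congr_of_eventuallyEq
      (Filter.Eventually.of_forall fun w => ?_)).mdifferentiableWithinAt
    exact congrArg f (mk_eq_mk_iff.2 ⟨γ⁻¹, inv_mem hγ, by simp [smul_point]⟩)

/-- The map `X_Γ → X_Γ'` is étale as soon as `Γ` contains all elliptic and parabolic elements
of `Γ'`, and `-1` if `Γ'` does. -/
theorem isEtale_map (h : Γ ≤ Γ') (H : ∀ γ ∈ Γ', |γ.1.trace| ≤ 2 → γ ∈ Γ) :
    IsEtale (map h) := by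
  intro x
  obtain ⟨x, rfl⟩ := mk_surjective x
  obtain ⟨U, hUo, hxU, hU⟩ := exists_isOpen_abs_trace_le_two x
  have hinj : Set.InjOn (map h) (mk Γ '' U) := by
    rintro _ ⟨u, hu, rfl⟩ _ ⟨v, hv, rfl⟩ huv
    obtain ⟨γ, hγ, rfl⟩ := mk_eq_mk_iff.1 huv
    exact mk_eq_mk_iff.2 ⟨γ, H γ hγ (hU γ v hv hu), rfl⟩
  have : Nonempty (ModularCurve Γ) := ⟨mk Γ x⟩
  let e := OpenPartialHomeomorph.ofContinuousOpen (hinj.toPartialEquiv _ _)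
    (continuous_map h).continuousOn (isOpenMap_map h) (isOpenMap_mk U hUo)
  exact ⟨e, ⟨x, hxU, rfl⟩, fun _ _ => rfl, fun V hV hVo f =>
    isHolomorphicOn_comp_map_iff h e (fun _ _ => rfl) hV hVo f⟩

/-! ### Fibres and cusps of `X_Γ̃ → X₀(p)` -/

theorem mk_GammaTilde_smul_eq_iff {p : ℕ} [Fact p.Prime] (x : ExtendedUpperHalfPlane)
    (γ δ : Gamma0 p) :
    mk (GammaTilde p) (γ.1 • x) = mk (GammaTilde p) (δ.1 • x) ↔
      gamma0Character p γ = gamma0Character p δ := by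
  rw [mk_eq_mk_iff]
  constructor
  · rintro ⟨ε, hε, h⟩
    let ε' : Gamma0 p := ⟨ε, hε.1⟩
    have hstab : (γ⁻¹ * (ε' * δ) : Gamma0 p).1 • x = x := by
      simp [ε', mul_smul, h]
    have h1 := gamma0Character_eq_one_iff.2 (mem_GammaTilde_of_abs_trace_le_two
      (γ⁻¹ * (ε' * δ) : Gamma0 p).2 (abs_trace_le_two_of_smul_eq hstab))
    have h2 : gamma0Character p ε' = 1 := gamma0Character_eq_one_iff.2 hε
    calc gamma0Character p γ = gamma0Character p (γ * (γ⁻¹ * (ε' * δ))) := by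
          rw [map_mul, h1, mul_one]
      _ = gamma0Character p δ := by rw [mul_inv_cancel_left, map_mul, h2, one_mul]
  · intro h
    refine ⟨(γ * δ⁻¹ : Gamma0 p).1, gamma0Character_eq_one_iff.1 ?_, ?_⟩
    · rw [map_mul, h, ← map_mul, mul_inv_cancel, map_one]
    · simp [mul_smul]

/-- All fibres of `π`, including those above cusps and elliptic points, have as many points as
the character `γ ↦ a ^ 12` has values. -/
theorem encard_fiber {p : ℕ} [Fact p.Prime] (y : ModularCurve (Gamma0 p)) :
    (map (GammaTilde_le p) ⁻¹' {y}).encard = (Set.range (gamma0Character p)).encard := by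
  obtain ⟨x, rfl⟩ := mk_surjective y
  let f : Gamma0 p → ModularCurve (GammaTilde p) := fun γ => mk (GammaTilde p) (γ.1 • x)
  have hfib : map (GammaTilde_le p) ⁻¹' {mk (Gamma0 p) x} = Set.range f := by
    ext w
    obtain ⟨w, rfl⟩ := mk_surjective w
    constructor
    · intro hw
      obtain ⟨γ, hγ, rfl⟩ := mk_eq_mk_iff.1 (show mk (Gamma0 p) w = mk (Gamma0 p) x from hw)
      exact ⟨⟨γ, hγ⟩, rfl⟩
    · rintro ⟨γ, hγ⟩
      rw [← hγ]
      exact mk_eq_mk_iff.2 ⟨γ.1, γ.2, rfl⟩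
  rw [hfib]
  exact Set.encard_congr ((Setoid.quotientKerEquivRange f).symm.trans
    ((Quotient.congrRight fun γ δ => mk_GammaTilde_smul_eq_iff x γ δ).trans
      (Setoid.quotientKerEquivRange (gamma0Character p))))

theorem three_le_encard_cusps {p : ℕ} [Fact p.Prime] (h : p ∉ ({2, 3, 5, 7, 13} : Set ℕ)) :
    3 ≤ (cusps (GammaTilde p)).encard := by
  obtain ⟨γ, hγ⟩ := exists_gamma0Character_ne_one h
  -- The cusps `∞` and `0 = S ∞` are not equivalent under `Γ₀(p)`.
  have hS : ∀ δ ∈ Gamma0 p, δ • cusp OnePoint.infty ≠ ModularGroup.S • cusp OnePoint.infty := by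
    intro δ hδ heq
    have hfix : (ModularGroup.S⁻¹ * δ) • cusp OnePoint.infty = cusp OnePoint.infty := by
      rw [mul_smul, heq, inv_smul_smul]
    have h00 : δ 0 0 = 0 := by
      have := smul_cusp_infty_eq_iff.1 hfix
      have h10 : (ModularGroup.S⁻¹ : SL(2, ℤ)) 1 0 = -1 := by
        rw [Matrix.SpecialLinearGroup.SL2_inv_expl]; rfl
      have h11 : (ModularGroup.S⁻¹ : SL(2, ℤ)) 1 1 = 0 := by
        rw [Matrix.SpecialLinearGroup.SL2_inv_expl]; rfl
      simpa [Matrix.mul_apply, h10, h11] using this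
    have := gamma0_apply_mul_apply hδ
    simp [h00] at this
  have hmem : ∀ δ : SL(2, ℤ), mk (GammaTilde p) (δ • cusp OnePoint.infty) ∈ cusps (GammaTilde p) :=
    fun δ => ⟨_, rfl⟩
  have hsub : ({mk (GammaTilde p) ((1 : Gamma0 p).1 • cusp OnePoint.infty),
      mk (GammaTilde p) (γ.1 • cusp OnePoint.infty),
      mk (GammaTilde p) (ModularGroup.S • cusp OnePoint.infty)} : Set (ModularCurve _)) ⊆
      cusps (GammaTilde p) := by
    rintro _ (rfl | rfl | rfl) <;> exact hmem _
  have hne : ∀ δ : Gamma0 p, mk (GammaTilde p) (δ.1 • cusp OnePoint.infty) ≠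
      mk (GammaTilde p) (ModularGroup.S • cusp OnePoint.infty) := by
    intro δ heq
    obtain ⟨ε, hε, h'⟩ := mk_eq_mk_iff.1 heq.symm
    exact hS (ε * δ.1) (mul_mem hε.1 δ.2) (by rw [mul_smul, h'])
  refine le_trans (le_of_eq ?_) (Set.encard_le_encard hsub)
  refine (Set.encard_eq_three.2 ⟨_, _, _, ?_, hne 1, hne γ, rfl⟩).symm
  rw [Ne, mk_GammaTilde_smul_eq_iff, map_one]
  exact hγ.symm

end ModularCurve

theorem proposition4 (p : ℕ) (hp : p.Prime) :
    (∃ d : ℕ, ModularCurve.HasDegree (ModularCurve.map (GammaTilde_le p)) d ∧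
      (p ≠ 2 → (d : ℝ) ≤ ((p : ℝ) - 1) / 2)) ∧
    (p ∉ ({2, 3, 5, 7, 13} : Set ℕ) →
      3 ≤ (ModularCurve.cusps (GammaTilde p)).encard) ∧
    ModularCurve.IsEtale (ModularCurve.map (GammaTilde_le p)) := by
  have : Fact p.Prime := ⟨hp⟩
  have hfin : (Set.range (gamma0Character p)).Finite := Set.toFinite _
  refine ⟨⟨(Set.range (gamma0Character p)).ncard, ?_, fun h2 => ?_⟩,
    ModularCurve.three_le_encard_cusps,
    ModularCurve.isEtale_map _ fun _ => mem_GammaTilde_of_abs_trace_le_two⟩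
  · have : {y : ModularCurve (Gamma0 p) | (ModularCurve.map (GammaTilde_le p) ⁻¹' {y}).encard ≠
        ((Set.range (gamma0Character p)).ncard : ℕ∞)} = ∅ := by
      ext y
      simp [ModularCurve.encard_fiber, hfin.cast_ncard_eq]
    rw [ModularCurve.HasDegree, this]
    exact Set.finite_empty
  · have h := encard_range_gamma0Character_le h2
    rw [← hfin.cast_ncard_eq, Nat.cast_le, Nat.le_div_iff_mul_le two_pos,
      Nat.le_sub_iff_add_le hp.one_le] at h
    rw [le_div_iff₀ two_pos, le_sub_iff_add_le]
    exact_mod_cast h
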